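/- Let $d\ge 2$ be an integer. A brick is a closed box $B=\prod_{i=1}^d[a_i,b_i]\subset\mathbb{R}^d$ with $a_i<b_i$ for all $i$; its sidelengths $b_i-a_i$, arranged in nondecreasing order, are denoted $w_1(B)\le\dots\le w_d(B)$, and $B$ is a cube if they are all equal. For a finite family $\mathcal{B}$ of bricks put \[\mathrm{vol}(\mathcal{B})=\sum_{B\in\mathcal{B}}w_1(B)w_2(B)\cdots w_d(B),\qquad \mathrm{surf}_\delta(\mathcal{B})=\sum_{B\in\mathcal{B}}w_1(B)^\delta w_2(B)\cdots w_d(B).\] Proposition 3.1. Let $\frac1d<t<\frac1{d-1}$ and $0<\delta<1$ with $(d-1)t+\delta t<1$, and let $C_1,C_2>0$. Then there is $M_0$ such that for every real $M\ge M_0$ there is $N_0\in\mathbb{N}$ with the following property. Let $n_{\max}\ge n_0\ge N_0$ be integers, and let $\mathcal{B}$ be a finite family of bricks with pairwise disjoint interiors such that \[\mathrm{vol}(\mathcal{B})=\sum_{n=n_0}^\infty\frac1{n^{dt}},\qquad \mathrm{surf}_\delta(\mathcal{B})\le \frac{C_1}{M^{1-\delta/2}}\sum_{n=1}^{n_0-1}\frac1{n^{(d-1)t+\delta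 t}},\qquad w_d(B)\le C_2\ \text{ for all } B\in\mathcal{B}.\] Then $\bigcup_{B\in\mathcal{B}}B$ can be packed by the cubes of sidelength $n^{-t}$, $n_0\le n<n_{\max}$: there are cubes $Q_n\subseteq\bigcup_{B\in\mathcal{B}}B$ with faces parallel to the coordinate hyperplanes, $Q_n$ of sidelength $n^{-t}$, for $n_0\le n<n_{\max}$, whose interiors are pairwise disjoint. -/

import Mathlib

/-- A brick positioned in `ℝ^d`: a closed, nondegenerate, axis-parallel box
`[a₁, b₁] × ⋯ × [a_d, b_d]`. -/
structure Brick (d : ℕ) where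
  lower : Fin d → ℝ
  upper : Fin d → ℝ
  lower_lt_upper : ∀ i, lower i < upper i

namespace Brick

variable {d : ℕ}

/-- The set of points of the brick. -/
def toSet (B : Brick d) : Set (Fin d → ℝ) := Set.Icc B.lower B.upper

/-- The sidelength in the `i`-th coordinate direction. -/
def side (B : Brick d) (i : Fin d) : ℝ := B.upper i - B.lower i

/-- The sidelengths in nondecreasing order. With indices starting from `0`, `B.w 0` is the width
of `B` and `B.w (d - 1)` is its largest sidelength. -/
noncomputable def w (B : Brick d) : Fin d → ℝ := B.side ∘ Tuple.sort B.side

/-- The volume `w₁ w₂ ⋯ w_d` of a brick. -/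
noncomputable def vol (B : Brick d) : ℝ := ∏ i, B.w i

/-- The weighted surface area `w₁ ^ δ * w₂ * ⋯ * w_d` of a brick. -/
noncomputable def surf (δ : ℝ) (B : Brick d) : ℝ :=
  ∏ i : Fin d, if (i : ℕ) = 0 then B.w i ^ δ else B.w i

/-- The brick is a cube of sidelength `s`. -/
def IsCube (B : Brick d) (s : ℝ) : Prop := ∀ i, B.side i = s

/-- The volume of a finite collection of bricks. -/
noncomputable def totalVol (𝓑 : Finset (Brick d)) : ℝ := ∑ B ∈ 𝓑, B.vol

/-- The weighted surface area of a finite collection of bricks. -/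
noncomputable def totalSurf (δ : ℝ) (𝓑 : Finset (Brick d)) : ℝ := ∑ B ∈ 𝓑, B.surf δ

/-- The bricks `Q i`, `i ∈ I`, form a packing: their interiors are pairwise disjoint. -/
def IsPacking {ι : Type*} (I : Set ι) (Q : ι → Brick d) : Prop :=
  I.Pairwise fun i j => Disjoint (interior (Q i).toSet) (interior (Q j).toSet)

/-- The solid `Ω` can be packed by cubes of sidelengths `s i`, `i ∈ I`. -/
def CanPackByCubes {ι : Type*} (Ω : Set (Fin d → ℝ)) (I : Set ι) (s : ι → ℝ) : Prop :=
  ∃ Q : ι → Brick d, (∀ i ∈ I, (Q i).IsCube (s i)) ∧ IsPacking I Q ∧ ∀ i ∈ I, (Q i).toSet ⊆ Ω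

end Brick

/-
The cubes are placed greedily, in rows. Suppose that the cubes of sidelengths `n ^ (-t)`, `n > m`,
are still to be placed, and put `s = m ^ (-t)`. If every remaining brick had width less than
`M * s`, the total volume would be at most `(M * s) ^ (1 - δ)` times the total weighted surface
area; as the surface area is at most a small multiple of `m ^ (1 - e)`, where `e` is the exponent
`(d - 1) * t + δ * t`, this would be less than a constant times `m ^ (1 - d * t)`, that is, less
than the volume of the cubes to be placed. So some brick `B` has all sidelengths at least `M * s`.

Inside `B` take one layer of a cubic grid of mesh `s`, and put each of the next `K` cubes in the
corner of its own cell, where `K` is the number of cells. The `d` slabs around the layer and the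
`K * d` shells around the cubes are new bricks. One slab costs no more surface than `B`, which is
removed; the other slabs are longer than they are thick by a factor `M`, and the shells are thin
because `K` is small compared with `m`. So the surface area grows by a small multiple of
`K * m ^ (-e)`, which the allowed growth from `m` to `m + K` absorbs, and the process continues.
-/

open Finset Filter

lemma rpow_mul_prod_erase {ι : Type*} [Fintype ι] [DecidableEq ι] (δ : ℝ) {x : ι → ℝ} {j : ι}
    (hj : 0 < x j) : x j ^ δ * ∏ l ∈ univ.erase j, x l = x j ^ (δ - 1) * ∏ l, x l := by
  rw [← mul_prod_erase univ x (mem_univ j), ← mul_assoc, ← Real.rpow_add_one hj.ne',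
    sub_add_cancel]

lemma rpow_neg_pow {x : ℝ} (hx : 0 ≤ x) (t : ℝ) (d : ℕ) :
    (x ^ (-t)) ^ d = 1 / x ^ ((d : ℝ) * t) := by
  rw [← Real.rpow_mul_natCast hx, one_div, ← Real.rpow_neg hx]
  ring_nf

lemma sub_one_rpow_le {e x : ℝ} (he₀ : 0 ≤ e) (he₁ : e ≤ 1) (hx : 1 ≤ x) :
    (x - 1) ^ (1 - e) ≤ x ^ (1 - e) - (1 - e) / x ^ e := by
  have hx₀ : 0 < x := by linarith
  have hbern : (1 + -(1 / x)) ^ (1 - e) ≤ 1 + (1 - e) * -(1 / x) :=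
    rpow_one_add_le_one_add_mul_self (by linarith [(div_le_one hx₀).2 hx])
      (sub_nonneg.2 he₁) (sub_le_self 1 he₀)
  calc (x - 1) ^ (1 - e) = x ^ (1 - e) * (1 + -(1 / x)) ^ (1 - e) := by
        rw [← Real.mul_rpow hx₀.le (by linarith [(div_le_one hx₀).2 hx])]
        congr 1
        field_simp
        ring
    _ ≤ x ^ (1 - e) * (1 + (1 - e) * -(1 / x)) :=
        mul_le_mul_of_nonneg_left hbern (Real.rpow_nonneg hx₀.le _)
    _ = x ^ (1 - e) - (1 - e) / x ^ e := by
        rw [Real.rpow_sub hx₀, Real.rpow_one]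
        field_simp
        ring

lemma sum_Ico_one_div_rpow_le {e : ℝ} (he₀ : 0 ≤ e) (he₁ : e < 1) (m : ℕ) :
    ∑ n ∈ Ico 1 (m + 1), 1 / (n : ℝ) ^ e ≤ (m : ℝ) ^ (1 - e) / (1 - e) := by
  have he : 0 < 1 - e := sub_pos.2 he₁
  induction m with
  | zero => simp [he.ne']
  | succ m ih =>
    have hstep := sub_one_rpow_le he₀ he₁.le (x := (m + 1 : ℕ)) (by simp)
    rw [Nat.cast_add_one, add_sub_cancel_right] at hstep
    calc ∑ n ∈ Ico 1 (m + 1 + 1), 1 / (n : ℝ) ^ e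
        ≤ (m : ℝ) ^ (1 - e) / (1 - e) + 1 / ((m : ℝ) + 1) ^ e := by
          rw [sum_Ico_succ_top (by lia), Nat.cast_add_one]
          gcongr
      _ = ((m : ℝ) ^ (1 - e) + (1 - e) / ((m : ℝ) + 1) ^ e) / (1 - e) := by
          rw [add_div, div_right_comm, div_self he.ne']
      _ ≤ ((m + 1 : ℕ) : ℝ) ^ (1 - e) / (1 - e) := by
          rw [Nat.cast_add_one]
          gcongr
          linarith

lemma mul_rpow_neg_le_sum_Ico {p : ℝ} (hp : 0 ≤ p) {m K : ℕ} (hm : 0 < m) (hK : K ≤ m) :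
    K * (2 ^ (-p) * (m : ℝ) ^ (-p)) ≤ ∑ n ∈ Ico (m + 1) (m + 1 + K), 1 / (n : ℝ) ^ p := by
  have hterm : ∀ n ∈ Ico (m + 1) (m + 1 + K), 2 ^ (-p) * (m : ℝ) ^ (-p) ≤ 1 / (n : ℝ) ^ p := by
    intro n hn
    rw [mem_Ico] at hn
    have hn₀ : (0 : ℝ) < n := by exact_mod_cast (by lia : 0 < n)
    have hn₂ : (n : ℝ) ≤ 2 * m := by exact_mod_cast (by lia : n ≤ 2 * m)
    rw [← Real.mul_rpow two_pos.le m.cast_nonneg, one_div, ← Real.rpow_neg hn₀.le]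
    exact Real.rpow_le_rpow_of_nonpos hn₀ hn₂ (neg_nonpos.2 hp)
  simpa using card_nsmul_le_sum _ _ _ hterm

lemma summable_one_div_nat_add_rpow {p : ℝ} (hp : 1 < p) (n₀ : ℕ) :
    Summable fun k : ℕ => 1 / ((n₀ + k : ℕ) : ℝ) ^ p := by
  simpa [add_comm] using (summable_nat_add_iff n₀).2 (Real.summable_one_div_nat_rpow.2 hp)

lemma tsum_one_div_nat_add_rpow {p : ℝ} (hp : 1 < p) (n₀ K : ℕ) :
    ∑' k : ℕ, 1 / ((n₀ + k : ℕ) : ℝ) ^ p =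
      ∑ n ∈ Ico n₀ (n₀ + K), 1 / (n : ℝ) ^ p + ∑' k : ℕ, 1 / ((n₀ + K + k : ℕ) : ℝ) ^ p := by
  rw [← (summable_one_div_nat_add_rpow hp n₀).sum_add_tsum_nat_add K, sum_Ico_eq_sum_range,
    add_tsub_cancel_left]
  simp only [add_assoc, add_comm K]

lemma rpow_neg_le_tsum {p : ℝ} (hp : 1 < p) {m : ℕ} (hm : 0 < m) :
    2 ^ (-p) * (m : ℝ) ^ (1 - p) ≤ ∑' k : ℕ, 1 / ((m + 1 + k : ℕ) : ℝ) ^ p := by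
  calc 2 ^ (-p) * (m : ℝ) ^ (1 - p) = m * (2 ^ (-p) * (m : ℝ) ^ (-p)) := by
        rw [sub_eq_add_neg, Real.rpow_one_add' m.cast_nonneg (by linarith)]
        ring
    _ ≤ ∑ n ∈ Ico (m + 1) (m + 1 + m), 1 / (n : ℝ) ^ p :=
        mul_rpow_neg_le_sum_Ico (zero_le_one.trans hp.le) hm le_rfl
    _ ≤ _ := by
        rw [tsum_one_div_nat_add_rpow hp (m + 1) m]
        exact le_add_of_nonneg_right (tsum_nonneg fun k => by positivity)

lemma sub_rpow_neg_le {t η x y : ℝ} (ht : t ≤ 1) (hx : 0 < x) (hxy : x ≤ y)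
    (hη : y - x ≤ η * x) : x ^ (-t) - y ^ (-t) ≤ η * x ^ (-t) := by
  have hy : 0 < y := hx.trans_le hxy
  have hratio : 1 - η ≤ (x / y) ^ t :=
    calc 1 - η ≤ x / y := by
          rw [le_div_iff₀ hy]
          nlinarith
      _ ≤ (x / y) ^ t := by
          simpa using Real.rpow_le_rpow_of_exponent_ge (div_pos hx hy) ((div_le_one hy).2 hxy) ht
  have hxt : 0 < x ^ (-t) := Real.rpow_pos_of_pos hx _
  have hyt : y ^ (-t) = (x / y) ^ t * x ^ (-t) := by
    rw [Real.div_rpow hx.le hy.le, Real.rpow_neg hx.le, Real.rpow_neg hy.le]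
    have := (Real.rpow_pos_of_pos hx t).ne'
    field_simp
  rw [hyt]
  nlinarith

lemma exists_nat_lt_le_add_one {x : ℝ} (hx : 1 < x) :
    ∃ k : ℕ, 1 ≤ k ∧ (k : ℝ) < x ∧ x ≤ k + 1 := by
  have hceil : 1 < ⌈x⌉₊ := Nat.lt_ceil.2 (by simpa)
  obtain ⟨k, hk⟩ : ∃ k, ⌈x⌉₊ = k + 1 := ⟨⌈x⌉₊ - 1, by lia⟩
  exact ⟨k, by lia, Nat.lt_ceil.1 (by lia), by exact_mod_cast hk ▸ Nat.le_ceil x⟩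

namespace Brick

section Geometry

variable {d : ℕ} {A A' B B' : Brick d}

lemma side_pos (B : Brick d) (i : Fin d) : 0 < B.side i := sub_pos.2 (B.lower_lt_upper i)

lemma prod_side (B : Brick d) : ∏ i, B.side i = B.vol :=
  (Equiv.prod_comp (Tuple.sort B.side) B.side).symm

lemma IsCube.vol_eq {s : ℝ} (h : B.IsCube s) : B.vol = s ^ d := by
  rw [← prod_side, prod_congr rfl fun i _ => h i, prod_const, card_univ, Fintype.card_fin]

lemma side_le_of_w_le {C : ℝ} (h : ∀ i, B.w i ≤ C) (i : Fin d) : B.side i ≤ C := by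
  simpa [w] using h ((Tuple.sort B.side).symm i)

lemma interior_toSet (B : Brick d) :
    interior B.toSet = Set.univ.pi fun i => Set.Ioo (B.lower i) (B.upper i) := by
  simp only [toSet, ← Set.pi_univ_Icc, interior_pi_set Set.finite_univ, interior_Icc]

lemma interior_toSet_nonempty (B : Brick d) : (interior B.toSet).Nonempty := by
  rw [interior_toSet]
  exact Set.univ_pi_nonempty_iff.2 fun i => Set.nonempty_Ioo.2 (B.lower_lt_upper i)

lemma closure_interior_toSet (B : Brick d) : closure (interior B.toSet) = B.toSet := by
  rw [interior_toSet, closure_pi_set, toSet, ← Set.pi_univ_Icc]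
  simp only [closure_Ioo (B.lower_lt_upper _).ne]

lemma disjoint_interior_of_upper_le {i : Fin d} (h : A.upper i ≤ B.lower i) :
    Disjoint (interior A.toSet) (interior B.toSet) := by
  rw [interior_toSet, interior_toSet]
  exact Set.disjoint_univ_pi.2 ⟨i, Set.disjoint_left.2 fun _ hA hB => (hA.2.trans_le h).not_gt hB.1⟩

lemma disjoint_interior_mono (h : Disjoint (interior A'.toSet) (interior B'.toSet))
    (hA : A.toSet ⊆ A'.toSet) (hB : B.toSet ⊆ B'.toSet) :
    Disjoint (interior A.toSet) (interior B.toSet) :=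
  h.mono (interior_mono hA) (interior_mono hB)

lemma disjoint_interior_toSet (h : Disjoint (interior A.toSet) (interior B.toSet)) :
    Disjoint (interior A.toSet) B.toSet := by
  rw [← closure_interior_toSet B]
  exact h.closure_right isOpen_interior

lemma side_le_of_subset (h : A.toSet ⊆ B.toSet) (i : Fin d) : A.side i ≤ B.side i := by
  obtain ⟨hl, hu⟩ := (Set.Icc_subset_Icc_iff fun i => (A.lower_lt_upper i).le).1 h
  exact sub_le_sub (hu i) (hl i)

end Geometry

section Surf

variable {d : ℕ} [NeZero d] {A B : Brick d} {δ : ℝ}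

lemma w_zero_pos (B : Brick d) : 0 < B.w 0 := B.side_pos _

lemma w_zero_le_side (B : Brick d) (i : Fin d) : B.w 0 ≤ B.side i := by
  simpa [w] using Tuple.monotone_sort B.side (Fin.zero_le ((Tuple.sort B.side).symm i))

lemma exists_side_eq_w_zero (B : Brick d) : ∃ i, B.side i = B.w 0 := ⟨Tuple.sort B.side 0, rfl⟩

lemma surf_eq_rpow_mul_vol (B : Brick d) : B.surf δ = B.w 0 ^ (δ - 1) * B.vol := by
  rw [vol, ← rpow_mul_prod_erase δ B.w_zero_pos, surf, ← mul_prod_erase _ _ (mem_univ 0)]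
  congr 1
  refine prod_congr rfl fun i hi => if_neg fun h => ne_of_mem_erase hi ?_
  exact Fin.val_eq_zero_iff.1 h

lemma surf_nonneg (B : Brick d) : 0 ≤ B.surf δ := by
  rw [surf_eq_rpow_mul_vol, ← prod_side]
  exact mul_nonneg (Real.rpow_nonneg B.w_zero_pos.le _) (prod_nonneg fun i _ => (B.side_pos i).le)

lemma vol_le_rpow_mul_surf (hδ : δ ≤ 1) {i : Fin d} {T : ℝ} (hi : B.side i ≤ T) :
    B.vol ≤ T ^ (1 - δ) * B.surf δ := by
  have hvol : B.vol = B.w 0 ^ (1 - δ) * B.surf δ := by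
    rw [surf_eq_rpow_mul_vol, ← mul_assoc, ← Real.rpow_add B.w_zero_pos]
    simp
  rw [hvol]
  exact mul_le_mul_of_nonneg_right (Real.rpow_le_rpow B.w_zero_pos.le
    ((B.w_zero_le_side i).trans hi) (sub_nonneg.2 hδ)) B.surf_nonneg

/- The weight `x_j ^ δ * ∏ l ≠ j, x_l` is largest when `j` is the shortest side, and monotone in
every sidelength; so it may be evaluated at the shortest side of `B` and then moved to `i`. -/
lemma surf_le_rpow_mul_prod_erase (hδ₀ : 0 ≤ δ) (hδ₁ : δ ≤ 1) {h : ℝ} {y : Fin d → ℝ} {i : Fin d}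
    (hi : B.side i ≤ h) (hy : ∀ l, l ≠ i → B.side l ≤ y l) (hhy : ∀ l, l ≠ i → h ≤ y l) :
    B.surf δ ≤ h ^ δ * ∏ l ∈ univ.erase i, y l := by
  have hh : 0 < h := (B.side_pos i).trans_le hi
  set z := Function.update y i h
  have hzi : z i = h := Function.update_self ..
  have hz : ∀ l, l ≠ i → z l = y l := fun l hl => Function.update_of_ne hl ..
  have hside : ∀ l, B.side l ≤ z l := fun l => by
    rcases eq_or_ne l i with rfl | hl
    exacts [hzi ▸ hi, hz l hl ▸ hy l hl]
  have hhz : ∀ l, h ≤ z l := fun l => by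
    rcases eq_or_ne l i with rfl | hl
    exacts [hzi.ge, hz l hl ▸ hhy l hl]
  obtain ⟨j, hj⟩ := B.exists_side_eq_w_zero
  calc B.surf δ = B.side j ^ δ * ∏ l ∈ univ.erase j, B.side l := by
        rw [rpow_mul_prod_erase δ (B.side_pos j), hj, prod_side, surf_eq_rpow_mul_vol]
    _ ≤ z j ^ δ * ∏ l ∈ univ.erase j, z l :=
        mul_le_mul (Real.rpow_le_rpow (B.side_pos j).le (hside j) hδ₀)
          (prod_le_prod (fun l _ => (B.side_pos l).le) fun l _ => hside l)
          (prod_nonneg fun l _ => (B.side_pos l).le)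
          (Real.rpow_nonneg (hh.le.trans (hhz j)) _)
    _ = z j ^ (δ - 1) * ∏ l, z l := rpow_mul_prod_erase δ (hh.trans_le (hhz j))
    _ ≤ h ^ (δ - 1) * ∏ l, z l :=
        mul_le_mul_of_nonneg_right (Real.rpow_le_rpow_of_nonpos hh (hhz j) (sub_nonpos.2 hδ₁))
          (prod_nonneg fun l _ => hh.le.trans (hhz l))
    _ = h ^ δ * ∏ l ∈ univ.erase i, y l := by
        rw [← hzi, ← rpow_mul_prod_erase δ (hzi.symm ▸ hh),
          prod_congr rfl fun l hl => hz l (ne_of_mem_erase hl)]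

lemma surf_le_of_subset (hδ₀ : 0 ≤ δ) (hδ₁ : δ ≤ 1) (h : A.toSet ⊆ B.toSet) :
    A.surf δ ≤ B.surf δ := by
  obtain ⟨j, hj⟩ := B.exists_side_eq_w_zero
  calc A.surf δ ≤ B.side j ^ δ * ∏ l ∈ univ.erase j, B.side l :=
        surf_le_rpow_mul_prod_erase hδ₀ hδ₁ (side_le_of_subset h j)
          (fun l _ => side_le_of_subset h l) fun l _ => hj ▸ B.w_zero_le_side l
    _ = B.surf δ := by
        rw [rpow_mul_prod_erase δ (B.side_pos j), hj, prod_side, surf_eq_rpow_mul_vol]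

end Surf

section Packing

variable {d : ℕ} {ι : Type*} {f : Brick d → ℝ}

lemma IsPacking.injOn {I : Set ι} {Q : ι → Brick d} (h : IsPacking I Q) : Set.InjOn Q I := by
  intro i hi j hj hij
  by_contra hne
  have hdisj := h hi hj hne
  simp only [hij, disjoint_self, Set.bot_eq_empty] at hdisj
  exact (Q j).interior_toSet_nonempty.ne_empty hdisj

lemma IsPacking.image [DecidableEq (Brick d)] {J : Finset ι} {G : ι → Brick d}
    (h : IsPacking (J : Set ι) G) : IsPacking (J.image G : Set (Brick d)) id := by
  rw [coe_image]
  exact h.injOn.pairwise_image.2 h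

lemma IsPacking.sum_image [DecidableEq (Brick d)] {J : Finset ι} {G : ι → Brick d}
    (h : IsPacking (J : Set ι) G) : ∑ B ∈ J.image G, f B = ∑ x ∈ J, f (G x) :=
  Finset.sum_image h.injOn

end Packing

section CornerCut

variable {d : ℕ} {B : Brick d} {p : Fin d → ℝ} {D : Fin (d + 1) → Brick d}

/-- `D` is a dissection of `B` by `d` successive hyperplane cuts, the `i`-th one at distance `p i`
from the lower facet of `B`: the piece above the `i`-th cut is `D i.castSucc`, and the corner box
with sidelengths `p` that remains in the end is `D (Fin.last d)`. -/
structure IsCornerCut (B : Brick d) (p : Fin d → ℝ) (D : Fin (d + 1) → Brick d) : Prop where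
  isPacking : IsPacking Set.univ D
  subset : ∀ j, (D j).toSet ⊆ B.toSet
  side_eq : ∀ j l, (D j).side l =
    if l.castSucc < j then p l else if l.castSucc = j then B.side l - p l else B.side l

lemma exists_isCornerCut (hp : ∀ i, p i ∈ Set.Ioo 0 (B.side i)) : ∃ D, IsCornerCut B p D := by
  have hupper : ∀ l, B.lower l + p l < B.upper l := fun l => lt_sub_iff_add_lt'.1 (hp l).2
  have hlower : ∀ l, B.lower l < B.lower l + p l := fun l => lt_add_of_pos_right _ (hp l).1
  let D : Fin (d + 1) → Brick d := fun j =>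
    { lower := fun l => if l.castSucc = j then B.lower l + p l else B.lower l
      upper := fun l => if l.castSucc < j then B.lower l + p l else B.upper l
      lower_lt_upper := fun l => by
        rcases lt_trichotomy l.castSucc j with h | h | h
        · simpa [h, h.ne] using (hp l).1
        · simpa [h] using hupper l
        · simpa [h.ne', h.not_gt] using B.lower_lt_upper l }
  have hD : ∀ j j', j < j' → Disjoint (interior (D j).toSet) (interior (D j').toSet) := by
    intro j j' hj
    obtain ⟨i, rfl⟩ := Fin.exists_castSucc_eq.2 (hj.trans_le (Fin.le_last j')).ne
    exact (disjoint_interior_of_upper_le (i := i) (by simp [D, hj])).symm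
  refine ⟨D, fun j _ j' _ hj => ?_, fun j => Set.Icc_subset_Icc (fun l => ?_) fun l => ?_,
    fun j l => ?_⟩
  · exact hj.lt_or_gt.elim (hD j j') fun h => (hD j' j h).symm
  · simp only [D]
    split_ifs
    exacts [(hlower l).le, le_rfl]
  · simp only [D]
    split_ifs
    exacts [(hupper l).le, le_rfl]
  · rcases lt_trichotomy l.castSucc j with h | h | h
    · simp [D, side, h, h.ne]
    · simp [D, side, h, sub_sub]
    · simp [D, side, h.ne', h.not_gt]

lemma IsCornerCut.side_last (hD : IsCornerCut B p D) (l : Fin d) :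
    (D (Fin.last d)).side l = p l := by
  rw [hD.side_eq, if_pos (Fin.castSucc_lt_last l)]

lemma IsCornerCut.sum_vol (hD : IsCornerCut B p D) :
    ∑ i : Fin d, (D i.castSucc).vol = B.vol - ∏ i, p i := by
  have hvol : ∀ i : Fin d, (D i.castSucc).vol =
      (B.side i - p i) * (∏ l with l < i, p l) * ∏ l with i < l, B.side l := by
    intro i
    have hi : B.side i - p i = ∏ l, if l = i then B.side l - p l else 1 := by simp
    rw [← prod_side, hi, prod_filter, prod_filter, ← prod_mul_distrib, ← prod_mul_distrib]
    refine prod_congr rfl fun l _ => ?_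
    rcases lt_trichotomy l i with h | h | h
    · simp [hD.side_eq, h, h.ne, h.not_gt]
    · simp [hD.side_eq, h]
    · simp [hD.side_eq, h, h.ne', h.not_gt]
  have hprod := prod_sub_ordered univ B.side fun i => B.side i - p i
  simp only [sub_sub_cancel] at hprod
  rw [hprod, prod_side, sub_sub_cancel, sum_congr rfl fun i _ => hvol i]

end CornerCut

section PartialPacking

variable {d : ℕ} {ι : Type*} {B : Brick d} {Ω : Set (Fin d → ℝ)} {I J : Set ι} {s r : ι → ℝ}
  {Q : ι → Brick d} {𝓑 𝓛 : Finset (Brick d)}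

lemma canPackByCubes_const_of_card_le {I : Finset ι} {s : ℝ} (hs : 0 < s) {k : Fin d → ℕ}
    (hk : ∀ i, k i * s ≤ B.side i) (hI : #I ≤ ∏ i, k i) :
    CanPackByCubes B.toSet (I : Set ι) fun _ => s := by
  let cell : (Fin d → ℕ) → Brick d := fun c =>
    { lower := fun i => B.lower i + c i * s
      upper := fun i => B.lower i + (c i + 1) * s
      lower_lt_upper := fun i => by linarith }
  have hcell : IsPacking Set.univ cell := by
    intro c _ c' _ hc
    obtain ⟨i, hi⟩ := Function.ne_iff.1 hc
    have hle : ∀ {a b : ℕ}, a < b → B.lower i + (a + 1) * s ≤ B.lower i + b * s := fun hab => by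
      gcongr
      exact_mod_cast hab
    rcases hi.lt_or_gt with hi | hi
    · exact disjoint_interior_of_upper_le (i := i) (hle hi)
    · exact (disjoint_interior_of_upper_le (i := i) (hle hi)).symm
  obtain ⟨c, hmaps, hinj⟩ : ∃ c : ι → Fin d → ℕ,
      (I : Set ι) ⊆ c ⁻¹' (Fintype.piFinset fun i => range (k i)) ∧ Set.InjOn c I :=
    I.finite_toSet.exists_injOn_of_encard_le <| by
      rw [Set.encard_coe_eq_coe_finsetCard, Set.encard_coe_eq_coe_finsetCard]
      exact_mod_cast by simpa [Fintype.card_piFinset] using hI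
  refine ⟨cell ∘ c, fun n _ i => ?_, fun n hn m hm hnm => ?_, fun n hn => ?_⟩
  · simp only [side, cell, Function.comp_apply]
    ring
  · exact hcell trivial trivial (hinj.ne hn hm hnm)
  · refine Set.Icc_subset_Icc (fun i => le_add_of_nonneg_right (by positivity)) fun i => ?_
    have hlt : c n i < k i := by simpa using Fintype.mem_piFinset.1 (hmaps hn) i
    calc B.lower i + (c n i + 1) * s ≤ B.lower i + k i * s := by
          gcongr
          exact_mod_cast hlt
      _ ≤ B.upper i := le_sub_iff_add_le'.1 (hk i)

/-- The cubes `Q n`, `n ∈ I`, of sidelengths `s n` form a packing of `Ω`, and the bricks of `𝓛`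
form a packing of what they leave free in `Ω`. -/
structure IsPartialPacking (Ω : Set (Fin d → ℝ)) (I : Set ι) (s : ι → ℝ) (Q : ι → Brick d)
    (𝓛 : Finset (Brick d)) : Prop where
  isCube : ∀ n ∈ I, (Q n).IsCube (s n)
  isPacking : IsPacking I Q
  isPacking_rest : IsPacking (𝓛 : Set (Brick d)) id
  disjoint : ∀ n ∈ I, ∀ L ∈ 𝓛, Disjoint (interior (Q n).toSet) (interior L.toSet)
  subset : ∀ n ∈ I, (Q n).toSet ⊆ Ω
  rest_subset : ∀ L ∈ 𝓛, L.toSet ⊆ Ω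

lemma CanPackByCubes.mono (h : CanPackByCubes Ω I s) (hJ : J ⊆ I) : CanPackByCubes Ω J s :=
  h.imp fun _ hQ => ⟨fun n hn => hQ.1 n (hJ hn), hQ.2.1.mono hJ, fun n hn => hQ.2.2 n (hJ hn)⟩

lemma IsPartialPacking.canPackByCubes (h : IsPartialPacking Ω I s Q 𝓛) : CanPackByCubes Ω I s :=
  ⟨Q, h.isCube, h.isPacking, h.subset⟩

lemma IsPartialPacking.canPackByCubes_union (h : IsPartialPacking Ω I s Q 𝓛)
    (hJ : CanPackByCubes (⋃ L ∈ 𝓛, L.toSet) J s) : CanPackByCubes Ω (I ∪ J) s := by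
  classical
  obtain ⟨R, hR, hRpack, hRsub⟩ := hJ
  have hcross : ∀ n ∈ I, ∀ m ∈ J, Disjoint (interior (Q n).toSet) (interior (R m).toSet) := by
    intro n hn m hm
    refine Disjoint.mono_right (interior_subset.trans (hRsub m hm)) ?_
    exact Set.disjoint_iUnion₂_right.2 fun L hL => disjoint_interior_toSet (h.disjoint n hn L hL)
  refine ⟨fun n => if n ∈ I then Q n else R n, fun n hn => ?_, fun n hn m hm hnm => ?_,
    fun n hn => ?_⟩
  · by_cases hnI : n ∈ I
    · simpa [hnI] using h.isCube n hnI
    · simpa [hnI] using hR n (hn.resolve_left hnI)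
  · by_cases hnI : n ∈ I <;> by_cases hmI : m ∈ I <;> simp only [hnI, hmI, if_true, if_false]
    · exact h.isPacking hnI hmI hnm
    · exact hcross n hnI m (hm.resolve_left hmI)
    · exact (hcross m hmI n (hn.resolve_left hnI)).symm
    · exact hRpack (hn.resolve_left hnI) (hm.resolve_left hmI) hnm
  · by_cases hnI : n ∈ I
    · simpa [hnI] using h.subset n hnI
    · simpa [hnI] using (hRsub n (hn.resolve_left hnI)).trans (Set.iUnion₂_subset h.rest_subset)

lemma IsPacking.disjoint_of_mem_erase [DecidableEq (Brick d)]
    (h𝓑 : IsPacking (𝓑 : Set (Brick d)) id) (hB : B ∈ 𝓑) {A L : Brick d} (hA : A ∈ 𝓑.erase B)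
    (hL : L.toSet ⊆ B.toSet) : Disjoint (interior L.toSet) (interior A.toSet) :=
  disjoint_interior_mono (h𝓑 hB (mem_of_mem_erase hA) (ne_of_mem_erase hA).symm) hL subset_rfl

lemma IsPartialPacking.erase_union [DecidableEq (Brick d)]
    (h : IsPartialPacking B.toSet I s Q 𝓛) (h𝓑 : IsPacking (𝓑 : Set (Brick d)) id) (hB : B ∈ 𝓑) :
    IsPartialPacking (⋃ A ∈ 𝓑, A.toSet) I s Q (𝓑.erase B ∪ 𝓛) where
  isCube := h.isCube
  isPacking := h.isPacking
  isPacking_rest := by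
    intro L hL L' hL' hne
    rw [mem_coe, mem_union] at hL hL'
    rcases hL with hL | hL <;> rcases hL' with hL' | hL'
    · exact h𝓑 (mem_of_mem_erase hL) (mem_of_mem_erase hL') hne
    · exact (h𝓑.disjoint_of_mem_erase hB hL (h.rest_subset L' hL')).symm
    · exact h𝓑.disjoint_of_mem_erase hB hL' (h.rest_subset L hL)
    · exact h.isPacking_rest hL hL' hne
  disjoint n hn L hL := (mem_union.1 hL).elim
    (fun hL => h𝓑.disjoint_of_mem_erase hB hL (h.subset n hn)) (h.disjoint n hn L)
  subset n hn := (h.subset n hn).trans (Set.subset_biUnion_of_mem (u := toSet) hB)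
  rest_subset L hL := (mem_union.1 hL).elim
    (fun hL => Set.subset_biUnion_of_mem (u := toSet) (mem_of_mem_erase hL))
    fun hL => (h.rest_subset L hL).trans (Set.subset_biUnion_of_mem (u := toSet) hB)

lemma IsPartialPacking.sum_erase_union [DecidableEq (Brick d)] (f : Brick d → ℝ)
    (h : IsPartialPacking B.toSet I s Q 𝓛) (h𝓑 : IsPacking (𝓑 : Set (Brick d)) id) (hB : B ∈ 𝓑) :
    ∑ L ∈ 𝓑.erase B ∪ 𝓛, f L = ∑ A ∈ 𝓑, f A - f B + ∑ L ∈ 𝓛, f L := by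
  have hdisj : Disjoint (𝓑.erase B) 𝓛 := disjoint_left.2 fun L hL hL' => by
    have hself := h𝓑.disjoint_of_mem_erase hB hL (h.rest_subset L hL')
    rw [disjoint_self] at hself
    exact L.interior_toSet_nonempty.ne_empty hself
  rw [sum_union hdisj, sum_erase_eq_sub hB]

lemma IsPartialPacking.shrink {I : Finset ι}
    (h : IsPartialPacking Ω I s Q 𝓛) {D : ι → Fin (d + 1) → Brick d}
    (hD : ∀ n ∈ I, IsCornerCut (Q n) (fun _ => r n) (D n)) :
    ∃ 𝓛' : Finset (Brick d), IsPartialPacking Ω I r (fun n => D n (Fin.last d)) 𝓛' ∧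
      ∀ f : Brick d → ℝ, ∑ L ∈ 𝓛', f L =
        ∑ L ∈ 𝓛, f L + ∑ n ∈ I, ∑ i : Fin d, f (D n i.castSucc) := by
  classical
  have hrest : ∀ n ∈ I, ∀ j, ∀ L ∈ 𝓛, Disjoint (interior (D n j).toSet) (interior L.toSet) :=
    fun n hn j L hL => disjoint_interior_mono (h.disjoint n hn L hL) ((hD n hn).subset j) subset_rfl
  have hpieces : ∀ n ∈ I, ∀ n' ∈ I, ∀ j j', (n, j) ≠ (n', j') →
      Disjoint (interior (D n j).toSet) (interior (D n' j').toSet) := by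
    intro n hn n' hn' j j' hne
    rcases eq_or_ne n n' with rfl | hnn
    · exact (hD n hn).isPacking trivial trivial fun hj => hne (by rw [hj])
    · exact disjoint_interior_mono (h.isPacking hn hn' hnn) ((hD n hn).subset j)
        ((hD n' hn').subset j')
  let G : Brick d ⊕ ι × Fin d → Brick d := Sum.elim id fun x => D x.1 x.2.castSucc
  have hG : IsPacking (𝓛.disjSum (I ×ˢ univ) : Finset (Brick d ⊕ ι × Fin d)) G := by
    rintro (L | ⟨n, i⟩) hx (L' | ⟨n', i'⟩) hy hne <;>
      simp only [mem_coe, inl_mem_disjSum, inr_mem_disjSum, mem_product, mem_univ, and_true]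
        at hx hy
    · exact h.isPacking_rest hx hy fun hL => hne (congrArg _ hL)
    · exact (hrest n' hy _ L hx).symm
    · exact hrest n hx _ L' hy
    · refine hpieces n hx n' hy _ _ fun heq => hne ?_
      simpa using heq
  refine ⟨(𝓛.disjSum (I ×ˢ univ)).image G, ⟨fun n hn => (hD n hn).side_last, ?_, hG.image, ?_,
    fun n hn => ((hD n hn).subset _).trans (h.subset n hn), ?_⟩, fun f => ?_⟩
  · exact fun n hn n' hn' hne => hpieces n hn n' hn' _ _ fun heq => hne (congrArg Prod.fst heq)
  · rintro n hn _ hL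
    obtain ⟨L | ⟨n', i⟩, hx, rfl⟩ := mem_image.1 hL
    · exact hrest n hn _ L (inl_mem_disjSum.1 hx)
    · exact hpieces n hn n' (mem_product.1 (inr_mem_disjSum.1 hx)).1 _ _
        fun heq => (Fin.castSucc_lt_last i).ne (congrArg Prod.snd heq).symm
  · intro _ hL
    obtain ⟨L | ⟨n, i⟩, hx, rfl⟩ := mem_image.1 hL
    · exact h.rest_subset L (inl_mem_disjSum.1 hx)
    · have hn := (mem_product.1 (inr_mem_disjSum.1 hx)).1
      exact ((hD n hn).subset _).trans (h.subset n hn)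
  · rw [hG.sum_image, sum_disjSum, sum_product]
    rfl

end PartialPacking

section FlatGrid

variable {d : ℕ} [NeZero d] {ι : Type*} {B : Brick d} {δ s η C M : ℝ} {k : Fin d → ℕ}
  {D : Fin (d + 1) → Brick d}

/-- A grid of cubic cells of sidelength `s` inside `B`: one layer of cells in direction `0`, and in
every other direction `i` the largest number `k i` of cells that does not fill `B`. -/
structure IsFlatGrid (B : Brick d) (s : ℝ) (k : Fin d → ℕ) : Prop where
  zero : k 0 = 1
  one_le : ∀ i, 1 ≤ k i
  lt_side : ∀ i, k i * s < B.side i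
  side_le : ∀ i, i ≠ 0 → B.side i ≤ (k i + 1) * s

lemma exists_isFlatGrid (hs : 0 < s) (h : ∀ i, s < B.side i) : ∃ k, IsFlatGrid B s k := by
  choose k hk₁ hk₂ hk₃ using fun i => exists_nat_lt_le_add_one ((one_lt_div hs).2 (h i))
  refine ⟨Function.update k 0 1, Function.update_self .., fun i => ?_, fun i => ?_, fun i hi => ?_⟩
  all_goals rcases eq_or_ne i 0 with rfl | hi₀
  · simp
  · simpa [hi₀] using hk₁ i
  · simpa using h 0
  · simpa [hi₀] using (lt_div_iff₀ hs).1 (hk₂ i)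
  · exact absurd rfl hi
  · simpa [hi₀] using (div_le_iff₀ hs).1 (hk₃ i)

lemma IsFlatGrid.prod_le (hk : IsFlatGrid B s k) (hs : 0 < s) (hC : ∀ i, B.side i ≤ C) :
    ∏ i, (k i : ℝ) ≤ (C / s) ^ (d - 1) := by
  have hki : ∀ i ∈ univ.erase 0, (k i : ℝ) ≤ C / s := fun i _ =>
    (le_div_iff₀ hs).2 ((hk.lt_side i).le.trans (hC i))
  rw [← mul_prod_erase univ _ (mem_univ 0), hk.zero, Nat.cast_one, one_mul]
  calc ∏ i ∈ univ.erase 0, (k i : ℝ) ≤ ∏ _i ∈ univ.erase (0 : Fin d), C / s :=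
        prod_le_prod (fun i _ => Nat.cast_nonneg _) hki
    _ = (C / s) ^ (d - 1) := by
        rw [prod_const, card_erase_of_mem (mem_univ 0), card_univ, Fintype.card_fin]

lemma IsFlatGrid.surf_castSucc_le (hk : IsFlatGrid B s k) (hs : 0 < s) (hδ₀ : 0 ≤ δ) (hδ₁ : δ ≤ 1)
    (hM₀ : 0 < M) (hM : ∀ i, M * s ≤ B.side i) (hD : IsCornerCut B (fun i => k i * s) D)
    {i : Fin d} (hi : i ≠ 0) :
    (D i.castSucc).surf δ ≤ 2 ^ d / M * (∏ l, (k l : ℝ)) * (s ^ (d - 1) * s ^ δ) := by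
  have hk₁ : ∀ l, (1 : ℝ) ≤ k l := fun l => by exact_mod_cast hk.one_le l
  have hMi : M ≤ 2 * k i := by
    have := le_of_mul_le_mul_right ((hM i).trans (hk.side_le i hi)) hs
    linarith [hk₁ i]
  have hside : ∀ l, l ≠ i → (D i.castSucc).side l ≤ 2 * s * k l := by
    intro l hl
    rw [hD.side_eq]
    split_ifs with hlt heq
    · nlinarith [hk₁ l]
    · exact absurd (Fin.castSucc_injective _ heq) hl
    · have hl₀ : l ≠ 0 := by
        rintro rfl
        exact hlt (Fin.castSucc_lt_castSucc_iff.2 (Fin.pos_iff_ne_zero.2 hi))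
      nlinarith [hk₁ l, hk.side_le l hl₀]
  calc (D i.castSucc).surf δ ≤ s ^ δ * ∏ l ∈ univ.erase i, 2 * s * k l := by
        refine surf_le_rpow_mul_prod_erase hδ₀ hδ₁ ?_ hside fun l _ => by nlinarith [hk₁ l]
        rw [hD.side_eq, if_neg (lt_irrefl _), if_pos rfl]
        linarith [hk.side_le i hi]
    _ = 2 ^ (d - 1) * (∏ l ∈ univ.erase i, (k l : ℝ)) * (s ^ (d - 1) * s ^ δ) := by
        rw [prod_mul_distrib, prod_const, card_erase_of_mem (mem_univ i), card_univ,
          Fintype.card_fin, mul_pow]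
        ring
    _ ≤ 2 ^ d / M * (∏ l, (k l : ℝ)) * (s ^ (d - 1) * s ^ δ) := by
        gcongr ?_ * _
        rw [← mul_prod_erase univ _ (mem_univ i), div_mul_eq_mul_div, le_div_iff₀ hM₀,
          ← mul_pow_sub_one (NeZero.ne d)]
        nlinarith [mul_le_mul_of_nonneg_left hMi (a := 2 ^ (d - 1) * ∏ l ∈ univ.erase i, (k l : ℝ))
          (by positivity)]

lemma IsCube.surf_castSucc_le (hB : B.IsCube s) (hs : 0 < s) (hδ₀ : 0 ≤ δ) (hδ₁ : δ ≤ 1) {r : ℝ}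
    (hD : IsCornerCut B (fun _ => r) D) (hη₀ : 0 ≤ η) (hη₁ : η ≤ 1) (hη : s - r ≤ η * s)
    (i : Fin d) :
    (D i.castSucc).surf δ ≤ η ^ δ * (s ^ (d - 1) * s ^ δ) := by
  calc (D i.castSucc).surf δ ≤ (η * s) ^ δ * ∏ _l ∈ univ.erase i, s := by
        refine surf_le_rpow_mul_prod_erase hδ₀ hδ₁ ?_ (fun l _ => ?_)
          fun _ _ => mul_le_of_le_one_left hs.le hη₁
        · rwa [hD.side_eq, if_neg (lt_irrefl _), if_pos rfl, hB]
        · exact (side_le_of_subset (hD.subset _) l).trans (hB l).le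
    _ = η ^ δ * (s ^ (d - 1) * s ^ δ) := by
        rw [prod_const, card_erase_of_mem (mem_univ i), card_univ, Fintype.card_fin,
          Real.mul_rpow hη₀ hs.le]
        ring

lemma IsFlatGrid.exists_isPartialPacking (hk : IsFlatGrid B s k) (hs : 0 < s) {I : Finset ι}
    (hI : #I = ∏ i, k i) :
    ∃ D Q 𝓢, IsCornerCut B (fun i => k i * s) D ∧
      IsPartialPacking B.toSet (I : Set ι) (fun _ => s) Q 𝓢 ∧
      ∀ f : Brick d → ℝ, ∑ S ∈ 𝓢, f S = ∑ i : Fin d, f (D i.castSucc) := by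
  classical
  obtain ⟨D, hD⟩ := exists_isCornerCut (B := B) (p := fun i => k i * s) fun i =>
    ⟨mul_pos (Nat.cast_pos.2 (hk.one_le i)) hs, hk.lt_side i⟩
  obtain ⟨Q, hQ, hpack, hsub⟩ :=
    canPackByCubes_const_of_card_le hs (fun i => (hD.side_last i).ge) hI.le
  have hcs : IsPacking ((univ : Finset (Fin d)) : Set (Fin d)) fun i => D i.castSucc :=
    fun i _ j _ hij => hD.isPacking trivial trivial ((Fin.castSucc_injective d).ne hij)
  refine ⟨D, Q, univ.image fun i : Fin d => D i.castSucc, hD,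
    ⟨hQ, hpack, hcs.image, ?_, fun n hn => (hsub n hn).trans (hD.subset _), ?_⟩,
    fun f => hcs.sum_image⟩
  · rintro n hn _ hS
    obtain ⟨i, -, rfl⟩ := mem_image.1 hS
    exact disjoint_interior_mono (hD.isPacking trivial trivial (Fin.castSucc_lt_last i).ne')
      (hsub n hn) subset_rfl
  · rintro _ hS
    obtain ⟨i, -, rfl⟩ := mem_image.1 hS
    exact hD.subset _

lemma IsFlatGrid.exists_isPartialPacking_of_lt (hk : IsFlatGrid B s k) (hs : 0 < s) (hδ₀ : 0 ≤ δ)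
    (hδ₁ : δ ≤ 1) (hM₀ : 0 < M) (hM : ∀ i, M * s ≤ B.side i) {I : Finset ι} (hI : #I = ∏ i, k i)
    {r : ι → ℝ} (hr : ∀ n ∈ I, r n ∈ Set.Ioo 0 s) (hη₀ : 0 ≤ η) (hη₁ : η ≤ 1)
    (hη : ∀ n ∈ I, s - r n ≤ η * s) :
    ∃ Q 𝓛, IsPartialPacking B.toSet (I : Set ι) r Q 𝓛 ∧
      totalVol 𝓛 = B.vol - ∑ n ∈ I, r n ^ d ∧
      totalSurf δ 𝓛 ≤ B.surf δ + #I * (d * (η ^ δ + 2 ^ d / M) * (s ^ (d - 1) * s ^ δ)) := by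
  classical
  obtain ⟨D, Q, 𝓢, hD, hQ, h𝓢⟩ := hk.exists_isPartialPacking hs hI
  have : Nonempty (Brick d) := ⟨B⟩
  choose! E hE using fun n (hn : n ∈ I) => exists_isCornerCut (B := Q n) (p := fun _ => r n)
    fun i => by rw [hQ.isCube n hn i]; exact hr n hn
  obtain ⟨𝓛, h𝓛, hsum⟩ := hQ.shrink hE
  have hK : (∏ i, (k i : ℝ)) = #I := by exact_mod_cast hI.symm
  have hslab : ∀ i : Fin d, (D i.castSucc).surf δ ≤
      (if i = 0 then B.surf δ else 0) + 2 ^ d / M * #I * (s ^ (d - 1) * s ^ δ) := by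
    intro i
    split_ifs with hi
    · exact le_add_of_le_of_nonneg (surf_le_of_subset hδ₀ hδ₁ (hD.subset _)) (by positivity)
    · rw [zero_add, ← hK]
      exact hk.surf_castSucc_le hs hδ₀ hδ₁ hM₀ hM hD hi
  have hshell : ∀ n ∈ I, ∀ i : Fin d,
      (E n i.castSucc).surf δ ≤ η ^ δ * (s ^ (d - 1) * s ^ δ) := fun n hn =>
    (hQ.isCube n hn).surf_castSucc_le hs hδ₀ hδ₁ (hE n hn) hη₀ hη₁ (hη n hn)
  refine ⟨_, 𝓛, h𝓛, ?_, ?_⟩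
  · have hcube : ∀ n ∈ I, ∑ i : Fin d, (E n i.castSucc).vol = s ^ d - r n ^ d := fun n hn => by
      rw [(hE n hn).sum_vol, (hQ.isCube n hn).vol_eq, prod_const, card_univ, Fintype.card_fin]
    rw [totalVol, hsum, h𝓢, hD.sum_vol, sum_congr rfl hcube, sum_sub_distrib, prod_mul_distrib, hK]
    simp
  · rw [totalSurf, hsum, h𝓢]
    calc ∑ i : Fin d, (D i.castSucc).surf δ + ∑ n ∈ I, ∑ i : Fin d, (E n i.castSucc).surf δ
        ≤ ∑ i : Fin d, ((if i = 0 then B.surf δ else 0) +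
              2 ^ d / M * #I * (s ^ (d - 1) * s ^ δ)) +
            ∑ _n ∈ I, ∑ _i : Fin d, η ^ δ * (s ^ (d - 1) * s ^ δ) :=
          add_le_add (sum_le_sum fun i _ => hslab i)
            (sum_le_sum fun n hn => sum_le_sum fun i _ => hshell n hn i)
      _ = B.surf δ + #I * (d * (η ^ δ + 2 ^ d / M) * (s ^ (d - 1) * s ^ δ)) := by
          simp only [sum_add_distrib, sum_ite_eq', mem_univ, if_true, sum_const, card_univ,
            Fintype.card_fin, nsmul_eq_mul]
          ring

end FlatGrid

section Exponents

variable {d : ℕ} {t δ C₁ η : ℝ}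

/-- The exponent of `1 / n` in the `δ`-weighted surface area of a cube of sidelength `n ^ (-t)`. -/
noncomputable def surfExponent (d : ℕ) (t δ : ℝ) : ℝ := ((d : ℝ) - 1) * t + δ * t

/-- The range of exponents in which the cubes of sidelengths `n ^ (-t)` have finite total volume
but infinite total `δ`-weighted surface area. -/
structure SubcriticalExponents (d : ℕ) (t δ : ℝ) : Prop where
  two_le : 2 ≤ d
  δ_pos : 0 < δ
  one_lt_mul : 1 < d * t
  surfExponent_lt_one : surfExponent d t δ < 1

lemma SubcriticalExponents.t_pos (h : SubcriticalExponents d t δ) : 0 < t :=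
  pos_of_mul_pos_right (one_pos.trans h.one_lt_mul) d.cast_nonneg

lemma SubcriticalExponents.δ_lt_one (h : SubcriticalExponents d t δ) : δ < 1 := by
  have hlt := h.surfExponent_lt_one
  rw [surfExponent] at hlt
  nlinarith [h.one_lt_mul, h.t_pos]

lemma SubcriticalExponents.surfExponent_pos (h : SubcriticalExponents d t δ) :
    0 < surfExponent d t δ := by
  have hd : (2 : ℝ) ≤ d := by exact_mod_cast h.two_le
  exact add_pos (mul_pos (by linarith) h.t_pos) (mul_pos h.δ_pos h.t_pos)

lemma SubcriticalExponents.sub_one_mul_lt_one (h : SubcriticalExponents d t δ) :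
    ((d : ℝ) - 1) * t < 1 :=
  (lt_add_of_pos_right _ (mul_pos h.δ_pos h.t_pos)).trans h.surfExponent_lt_one

lemma SubcriticalExponents.t_le_one (h : SubcriticalExponents d t δ) : t ≤ 1 := by
  have hd : (2 : ℝ) ≤ d := by exact_mod_cast h.two_le
  nlinarith [h.sub_one_mul_lt_one, h.t_pos]

lemma rpow_neg_pow_mul_rpow [NeZero d] {x : ℝ} (hx : 0 < x) (t δ : ℝ) :
    (x ^ (-t)) ^ (d - 1) * (x ^ (-t)) ^ δ = x ^ (-surfExponent d t δ) := by
  rw [← Real.rpow_mul_natCast hx.le, ← Real.rpow_mul hx.le, ← Real.rpow_add hx, surfExponent,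
    Nat.cast_pred (NeZero.pos d)]
  ring_nf

/-- Constants for which the greedy step works at every stage `m ≥ N₀`, when the remaining bricks
have sidelengths at most `C` and total `δ`-weighted surface area at most `A` times that of the
earlier cubes. A brick of width at least `M * m ^ (-t)` exists by `wide`; a flat grid of it contains
at most `η * m` cubes by `count`; and the surface area of the cuts around them is paid for by the
growth of the admissible surface area by `surf`. -/
structure IsStepSize (d : ℕ) (t δ A C M η : ℝ) (N₀ : ℕ) : Prop where
  A_nonneg : 0 ≤ A
  one_lt : 1 < M
  η_pos : 0 < η
  η_le_one : η ≤ 1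
  N₀_pos : 0 < N₀
  wide : M ^ (1 - δ) * A / (1 - surfExponent d t δ) < 2 ^ (-(d * t))
  surf : d * (η ^ δ + 2 ^ d / M) ≤ A * 2 ^ (-surfExponent d t δ)
  count : ∀ m : ℕ, N₀ ≤ m → (C / (m : ℝ) ^ (-t)) ^ (d - 1) ≤ η * m

lemma SubcriticalExponents.eventually_count (h : SubcriticalExponents d t δ) (C : ℝ)
    (hη : 0 < η) : ∀ᶠ m : ℕ in atTop, (C / (m : ℝ) ^ (-t)) ^ (d - 1) ≤ η * m := by
  obtain ⟨p, hp⟩ : ∃ p, p = 1 - ((d : ℝ) - 1) * t := ⟨_, rfl⟩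
  have hp₀ : 0 < p := hp ▸ sub_pos.2 h.sub_one_mul_lt_one
  have hlim : Tendsto (fun m : ℕ => C ^ (d - 1) * (m : ℝ) ^ (-p)) atTop (nhds 0) := by
    simpa only [mul_zero, Function.comp_def] using
      ((tendsto_rpow_neg_atTop hp₀).comp tendsto_natCast_atTop_atTop).const_mul (C ^ (d - 1))
  filter_upwards [hlim.eventually_le_const hη, eventually_gt_atTop 0] with m hm hm₀
  have hm₀ : (0 : ℝ) < m := Nat.cast_pos.2 hm₀
  calc (C / (m : ℝ) ^ (-t)) ^ (d - 1) = C ^ (d - 1) * (m : ℝ) ^ (-p) * m := by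
        rw [Real.rpow_neg hm₀.le, div_inv_eq_mul, mul_pow, ← Real.rpow_mul_natCast hm₀.le,
          Nat.cast_pred (by linarith [h.two_le]), mul_assoc, ← Real.rpow_add_one hm₀.ne', hp]
        ring_nf
    _ ≤ η * m := by gcongr

lemma SubcriticalExponents.eventually_isStepSize (h : SubcriticalExponents d t δ) (hC₁ : 0 < C₁)
    (C : ℝ) : ∀ᶠ M : ℝ in atTop, ∃ η N₀, IsStepSize d t δ (C₁ / M ^ (1 - δ / 2)) C M η N₀ := by
  have hδ := h.δ_pos
  have hlim : ∀ a b : ℝ, 0 < b → ∀ᶠ M : ℝ in atTop, a * M ^ (-(δ / 2)) < b := fun a b hb =>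
    ((tendsto_rpow_neg_atTop (half_pos hδ)).const_mul a).eventually_lt_const (by simpa)
  filter_upwards [hlim (C₁ / (1 - surfExponent d t δ)) (2 ^ (-(d * t))) (by positivity),
    hlim (2 * d * 2 ^ d) (C₁ * 2 ^ (-surfExponent d t δ)) (by positivity),
    eventually_gt_atTop 1, eventually_ge_atTop (2 ^ d)] with M hwide hsurf hM hMd
  have hM₀ : 0 < M := one_pos.trans hM
  have hη : 0 < ((2 : ℝ) ^ d / M) ^ δ⁻¹ := by positivity
  obtain ⟨N₀, hN₀, hcount⟩ :=
    ((eventually_gt_atTop 0).and (eventually_forall_ge_atTop.2 (h.eventually_count C hη))).exists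
  refine ⟨_, N₀, by positivity, hM, hη,
    Real.rpow_le_one (by positivity) ((div_le_one hM₀).2 hMd) (by positivity), hN₀, ?_, ?_, hcount⟩
  · calc M ^ (1 - δ) * (C₁ / M ^ (1 - δ / 2)) / (1 - surfExponent d t δ)
        = C₁ / (1 - surfExponent d t δ) * (M ^ (1 - δ) / M ^ (1 - δ / 2)) := by ring
      _ = C₁ / (1 - surfExponent d t δ) * M ^ (-(δ / 2)) := by
          rw [← Real.rpow_sub hM₀]
          ring_nf
      _ < _ := hwide
  · rw [Real.rpow_inv_rpow (by positivity) hδ.ne']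
    calc d * ((2 : ℝ) ^ d / M + 2 ^ d / M)
        = 2 * d * 2 ^ d * M ^ (-(δ / 2)) / M ^ (1 - δ / 2) := by
          rw [mul_div_assoc, ← Real.rpow_sub hM₀, show -(δ / 2) - (1 - δ / 2) = -1 by ring,
            Real.rpow_neg_one]
          ring
      _ ≤ C₁ * 2 ^ (-surfExponent d t δ) / M ^ (1 - δ / 2) := by gcongr
      _ = C₁ / M ^ (1 - δ / 2) * 2 ^ (-surfExponent d t δ) := by ring

end Exponents

section Greedy

variable {d : ℕ} [NeZero d] {t δ A C M η : ℝ} {N₀ m : ℕ} {B : Brick d} {𝓑 : Finset (Brick d)}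

/-- The hypotheses on the bricks left when exactly the cubes of sidelengths `n ^ (-t)`, `n₀ ≤ n`,
have not been placed yet. The surface bound grows with `n₀`, so it survives the cutting. -/
structure IsAdmissible (t δ A C : ℝ) (n₀ : ℕ) (𝓑 : Finset (Brick d)) : Prop where
  isPacking : IsPacking (𝓑 : Set (Brick d)) id
  totalVol_eq : totalVol 𝓑 = ∑' k : ℕ, 1 / ((n₀ + k : ℕ) : ℝ) ^ ((d : ℝ) * t)
  totalSurf_le : totalSurf δ 𝓑 ≤ A * ∑ n ∈ Ico 1 n₀, 1 / (n : ℝ) ^ surfExponent d t δ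
  side_le : ∀ B ∈ 𝓑, ∀ i, B.side i ≤ C

lemma totalVol_le_rpow_mul_totalSurf {T : ℝ} (hδ : δ ≤ 1) (h : ∀ B ∈ 𝓑, ∃ i, B.side i ≤ T) :
    totalVol 𝓑 ≤ T ^ (1 - δ) * totalSurf δ 𝓑 := by
  rw [totalVol, totalSurf, mul_sum]
  exact sum_le_sum fun B hB => vol_le_rpow_mul_surf hδ (h B hB).choose_spec

lemma IsAdmissible.exists_wide (h𝓑 : IsAdmissible t δ A C (m + 1) 𝓑)
    (hexp : SubcriticalExponents d t δ) (hstep : IsStepSize d t δ A C M η N₀) (hm : 0 < m) :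
    ∃ B ∈ 𝓑, ∀ i, M * (m : ℝ) ^ (-t) ≤ B.side i := by
  by_contra! hthin
  set e := surfExponent d t δ with he
  have hm₀ : (0 : ℝ) < m := Nat.cast_pos.2 hm
  have hM₀ : 0 ≤ M := zero_le_one.trans hstep.one_lt.le
  have hle : totalVol 𝓑 ≤ M ^ (1 - δ) * A / (1 - e) * (m : ℝ) ^ (1 - d * t) :=
    calc totalVol 𝓑 ≤ (M * (m : ℝ) ^ (-t)) ^ (1 - δ) * totalSurf δ 𝓑 :=
          totalVol_le_rpow_mul_totalSurf hexp.δ_lt_one.le fun B hB =>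
            (hthin B hB).imp fun _ hi => hi.le
      _ ≤ (M * (m : ℝ) ^ (-t)) ^ (1 - δ) * (A * ((m : ℝ) ^ (1 - e) / (1 - e))) := by
          gcongr
          exact h𝓑.totalSurf_le.trans (mul_le_mul_of_nonneg_left
            (sum_Ico_one_div_rpow_le hexp.surfExponent_pos.le hexp.surfExponent_lt_one m)
            hstep.A_nonneg)
      _ = M ^ (1 - δ) * A / (1 - e) * ((m : ℝ) ^ (-t * (1 - δ)) * (m : ℝ) ^ (1 - e)) := by
          rw [Real.mul_rpow hM₀ (by positivity), ← Real.rpow_mul hm₀.le]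
          ring
      _ = M ^ (1 - δ) * A / (1 - e) * (m : ℝ) ^ (1 - d * t) := by
          rw [← Real.rpow_add hm₀, he, surfExponent]
          ring_nf
  have hlt : totalVol 𝓑 < totalVol 𝓑 :=
    calc totalVol 𝓑 < 2 ^ (-(d * t)) * (m : ℝ) ^ (1 - d * t) :=
          hle.trans_lt (mul_lt_mul_of_pos_right hstep.wide (by positivity))
      _ ≤ totalVol 𝓑 := h𝓑.totalVol_eq ▸ rpow_neg_le_tsum hexp.one_lt_mul hm
  exact hlt.false

lemma exists_isPartialPacking_of_wide (hexp : SubcriticalExponents d t δ)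
    (hstep : IsStepSize d t δ A C M η N₀) (hm : N₀ ≤ m)
    (hwide : ∀ i, M * (m : ℝ) ^ (-t) ≤ B.side i) (hC : ∀ i, B.side i ≤ C) :
    ∃ (K : ℕ) (Q : ℕ → Brick d) (𝓛 : Finset (Brick d)), 0 < K ∧
      IsPartialPacking B.toSet (Set.Ico (m + 1) (m + 1 + K)) (fun n : ℕ => (n : ℝ) ^ (-t)) Q 𝓛 ∧
      totalVol 𝓛 = B.vol - ∑ n ∈ Ico (m + 1) (m + 1 + K), 1 / (n : ℝ) ^ ((d : ℝ) * t) ∧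
      totalSurf δ 𝓛 ≤ B.surf δ +
        A * ∑ n ∈ Ico (m + 1) (m + 1 + K), 1 / (n : ℝ) ^ surfExponent d t δ := by
  have hm₀ : 0 < m := hstep.N₀_pos.trans_le hm
  have hm₁ : (0 : ℝ) < m := Nat.cast_pos.2 hm₀
  have hM₀ : 0 < M := one_pos.trans hstep.one_lt
  have hs : 0 < (m : ℝ) ^ (-t) := Real.rpow_pos_of_pos hm₁ _
  obtain ⟨k, hk⟩ := exists_isFlatGrid hs fun i =>
    (lt_mul_of_one_lt_left hs hstep.one_lt).trans_le (hwide i)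
  set K := ∏ i, k i
  have hK₀ : 0 < K := prod_pos fun i _ => hk.one_le i
  have hKη : (K : ℝ) ≤ η * m := by
    simpa [K] using (hk.prod_le hs hC).trans (hstep.count m hm)
  have hKm : K ≤ m := by
    exact_mod_cast hKη.trans (mul_le_of_le_one_left hm₁.le hstep.η_le_one)
  have hside : ∀ n ∈ Ico (m + 1) (m + 1 + K), (n : ℝ) ^ (-t) ∈ Set.Ioo 0 ((m : ℝ) ^ (-t)) ∧
      (m : ℝ) ^ (-t) - (n : ℝ) ^ (-t) ≤ η * (m : ℝ) ^ (-t) := by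
    intro n hn
    rw [mem_Ico] at hn
    have hmn : (m : ℝ) < n := by exact_mod_cast hn.1
    have hnK : (n : ℝ) ≤ m + K := by exact_mod_cast (by lia : n ≤ m + K)
    exact ⟨⟨Real.rpow_pos_of_pos (hm₁.trans hmn) _,
      Real.rpow_lt_rpow_of_neg hm₁ hmn (neg_lt_zero.2 hexp.t_pos)⟩,
      sub_rpow_neg_le hexp.t_le_one hm₁ hmn.le (by linarith)⟩
  obtain ⟨Q, 𝓛, hQ, hvol, hsurf⟩ := hk.exists_isPartialPacking_of_lt hs hexp.δ_pos.le
    hexp.δ_lt_one.le hM₀ hwide (by simp [K]) (fun n hn => (hside n hn).1) hstep.η_pos.le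
    hstep.η_le_one fun n hn => (hside n hn).2
  refine ⟨K, Q, 𝓛, hK₀, by simpa using hQ, ?_, hsurf.trans (add_le_add_right ?_ _)⟩
  · simpa only [rpow_neg_pow (Nat.cast_nonneg _)] using hvol
  · rw [rpow_neg_pow_mul_rpow hm₁, Nat.card_Ico, add_tsub_cancel_left]
    calc K * (d * (η ^ δ + 2 ^ d / M) * (m : ℝ) ^ (-surfExponent d t δ))
        ≤ K * (A * 2 ^ (-surfExponent d t δ) * (m : ℝ) ^ (-surfExponent d t δ)) := by
          gcongr K * (?_ * _)
          exact hstep.surf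
      _ = A * (K * (2 ^ (-surfExponent d t δ) * (m : ℝ) ^ (-surfExponent d t δ))) := by ring
      _ ≤ _ := mul_le_mul_of_nonneg_left
          (mul_rpow_neg_le_sum_Ico hexp.surfExponent_pos.le hm₀ hKm) hstep.A_nonneg

lemma IsAdmissible.exists_isPartialPacking {n₀ : ℕ} (h𝓑 : IsAdmissible t δ A C n₀ 𝓑)
    (hexp : SubcriticalExponents d t δ) (hstep : IsStepSize d t δ A C M η N₀) (hn₀ : N₀ < n₀) :
    ∃ (K : ℕ) (Q : ℕ → Brick d) (𝓛 : Finset (Brick d)), 0 < K ∧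
      IsPartialPacking (⋃ B ∈ 𝓑, B.toSet) (Set.Ico n₀ (n₀ + K)) (fun n : ℕ => (n : ℝ) ^ (-t)) Q 𝓛 ∧
      IsAdmissible t δ A C (n₀ + K) 𝓛 := by
  classical
  obtain ⟨m, rfl⟩ : ∃ m, n₀ = m + 1 := ⟨n₀ - 1, by lia⟩
  obtain ⟨B, hB, hwide⟩ := h𝓑.exists_wide hexp hstep (hstep.N₀_pos.trans_le (by lia))
  obtain ⟨K, Q, 𝓛, hK, hQ, hvol, hsurf⟩ :=
    exists_isPartialPacking_of_wide hexp hstep (by lia) hwide (h𝓑.side_le B hB)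
  have hQ' := hQ.erase_union h𝓑.isPacking hB
  refine ⟨K, Q, 𝓑.erase B ∪ 𝓛, hK, hQ', hQ'.isPacking_rest, ?_, ?_, fun L hL i => ?_⟩
  · have hsum : totalVol (𝓑.erase B ∪ 𝓛) = totalVol 𝓑 - B.vol + totalVol 𝓛 :=
      hQ.sum_erase_union vol h𝓑.isPacking hB
    rw [hsum, hvol, h𝓑.totalVol_eq, tsum_one_div_nat_add_rpow hexp.one_lt_mul (m + 1) K]
    ring
  · have hsum : totalSurf δ (𝓑.erase B ∪ 𝓛) = totalSurf δ 𝓑 - B.surf δ + totalSurf δ 𝓛 :=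
      hQ.sum_erase_union (surf δ) h𝓑.isPacking hB
    rw [hsum, ← sum_Ico_consecutive _ (by lia : 1 ≤ m + 1) (Nat.le_add_right _ K), mul_add]
    linarith [h𝓑.totalSurf_le]
  · rcases mem_union.1 hL with hL | hL
    · exact h𝓑.side_le L (mem_of_mem_erase hL) i
    · exact (side_le_of_subset (hQ.rest_subset L hL) i).trans (h𝓑.side_le B hB i)

theorem IsAdmissible.canPackByCubes {n₀ : ℕ} (h𝓑 : IsAdmissible t δ A C n₀ 𝓑)
    (hexp : SubcriticalExponents d t δ) (hstep : IsStepSize d t δ A C M η N₀) (hn₀ : N₀ < n₀)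
    (nmax : ℕ) :
    CanPackByCubes (⋃ B ∈ 𝓑, B.toSet) (Set.Ico n₀ nmax) fun n : ℕ => (n : ℝ) ^ (-t) := by
  induction hj : nmax - n₀ using Nat.strong_induction_on generalizing n₀ 𝓑 with
  | _ j ih =>
    obtain ⟨K, Q, 𝓛, hK, hQ, h𝓛⟩ := h𝓑.exists_isPartialPacking hexp hstep hn₀
    rcases le_or_gt nmax (n₀ + K) with hle | hlt
    · exact hQ.canPackByCubes.mono (Set.Ico_subset_Ico_right hle)
    · rw [← Set.Ico_union_Ico_eq_Ico (Nat.le_add_right n₀ K) hlt.le]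
      exact hQ.canPackByCubes_union (ih _ (by lia) h𝓛 (by lia) rfl)

end Greedy

end Brick

theorem proposition3p1 (d : ℕ) (hd : 2 ≤ d) (t δ : ℝ)
    (ht₁ : 1 / (d : ℝ) < t) (ht₂ : t < 1 / ((d : ℝ) - 1))
    (hδ₀ : 0 < δ) (hδ₁ : δ < 1) (htδ : ((d : ℝ) - 1) * t + δ * t < 1)
    (C₁ C₂ : ℝ) (hC₁ : 0 < C₁) (hC₂ : 0 < C₂) :
    ∃ M₀ : ℝ, ∀ M : ℝ, M₀ ≤ M → ∃ N₀ : ℕ, ∀ n₀ nmax : ℕ, N₀ ≤ n₀ → n₀ ≤ nmax →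
      ∀ 𝓑 : Finset (Brick d),
        Brick.IsPacking (𝓑 : Set (Brick d)) id →
        Brick.totalVol 𝓑 = ∑' k : ℕ, 1 / ((n₀ + k : ℕ) : ℝ) ^ ((d : ℝ) * t) →
        Brick.totalSurf δ 𝓑 ≤ C₁ * (1 / M ^ (1 - δ / 2) *
          ∑ n ∈ Finset.Ico 1 n₀, 1 / (n : ℝ) ^ (((d : ℝ) - 1) * t + δ * t)) →
        (∀ B ∈ 𝓑, ∀ i, B.w i ≤ C₂) →
        Brick.CanPackByCubes (⋃ B ∈ 𝓑, B.toSet) (Set.Ico n₀ nmax) (fun n : ℕ => (n : ℝ) ^ (-t)) := by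
  have : NeZero d := ⟨by lia⟩
  have hexp : Brick.SubcriticalExponents d t δ :=
    ⟨hd, hδ₀, (div_lt_iff₀' (by positivity)).1 ht₁, htδ⟩
  obtain ⟨M₀, hM₀⟩ := eventually_atTop.1 (hexp.eventually_isStepSize hC₁ C₂)
  refine ⟨M₀, fun M hM => ?_⟩
  obtain ⟨η, N₀, hstep⟩ := hM₀ M hM
  refine ⟨N₀ + 1, fun n₀ nmax hn₀ _ 𝓑 hpack hvol hsurf hw => ?_⟩
  have h𝓑 : Brick.IsAdmissible t δ (C₁ / M ^ (1 - δ / 2)) C₂ n₀ 𝓑 :=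
    { isPacking := hpack
      totalVol_eq := hvol
      totalSurf_le := by rwa [div_eq_mul_one_div, mul_assoc]
      side_le := fun B hB => Brick.side_le_of_w_le (hw B hB) }
  exact h𝓑.canPackByCubes hexp hstep hn₀ nmax
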